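/- Let $\mathbb{D}$ be the open unit disc, $\sigma$ the normalized area measure on $\mathbb{D}$ (so $\sigma(\mathbb{D})=1$), and for $1<p<\infty$ let $A^p$ be the Bergman space of analytic functions $f$ in $\mathbb{D}$ with $\|f\|_{A^p}=\left(\int_{\mathbb{D}}|f|^p\,d\sigma\right)^{1/p}<\infty$. For an analytic function $F$ in $\mathbb{D}$ and real $a$, an analytic function $G$ in $\mathbb{D}$ is called a branch of $F^a$ if near every point of $\mathbb{D}$ at which $F\neq 0$ we have $G=e^{aL}$ for some analytic function $L$ with $e^L=F$; zeros of $F$ are allowed only if $a\ge 0$, and at them $G=0^a$ (that is, $G=0$ if $a>0$ and $G=1$ if $a=0$). Theorem. Let $1<p<\infty$, let $F\in A^p$, and suppose that some branch of $F^{p/2}$ is a polynomial of degree $N$ (the zero polynomial being counted as of degree $0$). If $p<2$, suppose furthermore that some branch of $F^{(p/2)-1}$ belongs to $A^{p_1}$ for some real $p_1>1$. Then $$\|F\|_{A^p}=\min\{\|f\|_{A^p} : f\in A^p,\ f^{(j)}(0)=F^{(j)}(0)\text{ for } 0\le j\le N\};$$ that is, the infimum of the norms on the right is attained at $F$. -/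

import Mathlib

/-- Normalized area measure `σ` on the open unit disc of `ℂ`, so that `σ(𝔻) = 1`. -/
noncomputable def diskMeasure : MeasureTheory.Measure ℂ :=
  (ENNReal.ofReal Real.pi)⁻¹ •
    (MeasureTheory.volume : MeasureTheory.Measure ℂ).restrict (Metric.ball (0 : ℂ) 1)

/-- `f` belongs to the Bergman space `A^p`: it is analytic in the open unit disc and `|f|^p` is
integrable over the disc. Values of `f` outside the disc play no role. -/
def MemBergman (p : ℝ) (f : ℂ → ℂ) : Prop :=
  AnalyticOnNhd ℂ f (Metric.ball (0 : ℂ) 1) ∧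
    MeasureTheory.Integrable (fun z => ‖f z‖ ^ p) diskMeasure

/-- The norm `‖f‖_{A^p} = (∫_𝔻 |f|^p dσ)^{1/p}`. -/
noncomputable def bergmanNorm (p : ℝ) (f : ℂ → ℂ) : ℝ :=
  (∫ z, ‖f z‖ ^ p ∂diskMeasure) ^ (1 / p)

/-- `G` is an analytic function in the open unit disc that is (a branch of) the power `F ^ a`, for a
real exponent `a`. Near each point of the disc where `F` does not vanish, `G = exp (a L)` for some
analytic logarithm `L` of `F`. Zeros of `F` are allowed only when `0 ≤ a`, and there
`G = 0 ^ a`, which is `0` if `0 < a` and `1` if `a = 0`. -/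
def IsPowerBranch (F : ℂ → ℂ) (a : ℝ) (G : ℂ → ℂ) : Prop :=
  AnalyticOnNhd ℂ G (Metric.ball (0 : ℂ) 1) ∧
    ∀ z ∈ Metric.ball (0 : ℂ) 1,
      (F z ≠ 0 → ∃ L : ℂ → ℂ, AnalyticAt ℂ L z ∧
        ∀ᶠ w in nhds z, Complex.exp (L w) = F w ∧ G w = Complex.exp ((a : ℂ) * L w)) ∧
      (F z = 0 → 0 ≤ a ∧ G z = (0 : ℂ) ^ (a : ℂ))

open MeasureTheory Metric Filter Topology Real ComplexConjugate

/-- If all circle averages of `φ` around `0` of radius less than `R` vanish, so does the integral of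
`φ` over the disc of radius `R`. -/
theorem setIntegral_ball_eq_zero_of_circleAverage_eq_zero {φ : ℂ → ℂ} {R : ℝ}
    (h : ∀ ρ : ℝ, 0 < ρ → ρ < R → circleAverage φ 0 ρ = 0) :
    ∫ z in ball (0 : ℂ) R, φ z = 0 := by
  rw [← integral_indicator measurableSet_ball, ← Complex.integral_comp_polarCoord_symm]
  change ∫ p in Set.Ioi (0 : ℝ) ×ˢ Set.Ioo (-π) π, _ = _
  set ψ : ℝ × ℝ → ℂ := fun p =>
    p.1 • (ball (0 : ℂ) R).indicator φ (Complex.polarCoord.symm p) with hψ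
  by_cases hi : IntegrableOn ψ (Set.Ioi (0 : ℝ) ×ˢ Set.Ioo (-π) π) (volume.prod volume)
  · rw [Measure.volume_eq_prod, setIntegral_prod _ hi]
    refine setIntegral_eq_zero_of_forall_eq_zero fun ρ hρ => ?_
    have hρ' : 0 < ρ := hρ
    have hn : ∀ θ : ℝ, ‖Complex.polarCoord.symm (ρ, θ)‖ = ρ := fun θ => by
      rw [Complex.norm_polarCoord_symm, abs_of_pos hρ']
    have hc : ∀ θ : ℝ, Complex.polarCoord.symm (ρ, θ) = circleMap 0 ρ θ := fun θ => by
      simp [circleMap, Complex.exp_mul_I]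
    simp only [hψ]
    rw [integral_smul]
    by_cases hR : ρ < R
    · have hin : ∀ θ : ℝ, (ball (0 : ℂ) R).indicator φ (Complex.polarCoord.symm (ρ, θ)) =
          φ (circleMap 0 ρ θ) := fun θ => by
        rw [Set.indicator_of_mem (by rwa [mem_ball_zero_iff, hn]), hc]
      simp only [hin]
      have hper : Function.Periodic (fun θ => φ (circleMap 0 ρ θ)) (2 * π) := fun θ => by
        simp only [periodic_circleMap 0 ρ θ]
      have h0 := h ρ hρ' hR
      rw [circleAverage_def, smul_eq_zero_iff_right (by positivity)] at h0
      have h1 := hper.intervalIntegral_add_eq (-π) 0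
      rw [zero_add, h0, show -π + 2 * π = π by ring,
        intervalIntegral.integral_of_le (by linarith [pi_pos]), integral_Ioc_eq_integral_Ioo] at h1
      rw [h1, smul_zero]
    · have hin : ∀ θ : ℝ, (ball (0 : ℂ) R).indicator φ (Complex.polarCoord.symm (ρ, θ)) = 0 :=
        fun θ => Set.indicator_of_notMem (by rwa [mem_ball_zero_iff, hn]) _
      simp only [hin, integral_zero, smul_zero]
  · exact integral_undef hi

/-- An analytic function on the disc with a zero of order at least `n` at `0` is divisible by
`z ^ n`. -/
theorem AnalyticOnNhd.exists_eq_pow_mul {U : Set ℂ} {K : ℂ → ℂ} (hK : AnalyticOnNhd ℂ K U)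
    {n : ℕ} (h0 : (0 : ℂ) ∈ U) (hn : (n : ℕ∞) ≤ analyticOrderAt K 0) :
    ∃ g : ℂ → ℂ, AnalyticOnNhd ℂ g U ∧ ∀ z, K z = z ^ n * g z := by
  classical
  obtain ⟨g₀, hg₀, hKg⟩ := (natCast_le_analyticOrderAt (hK 0 h0)).1 hn
  refine ⟨fun z => if z = 0 then (if n = 0 then K 0 else g₀ 0) else K z / z ^ n, fun z hz => ?_,
    fun z => ?_⟩
  · by_cases hz0 : z = 0
    · subst hz0
      refine hg₀.congr ?_
      filter_upwards [hKg] with w hw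
      split_ifs with h1 h2
      · subst h1 h2; simpa using hw.symm
      · rw [h1]
      · rw [hw]; simp [h1]
    · refine ((hK z hz).div (analyticAt_id.pow n) (pow_ne_zero n hz0)).congr ?_
      filter_upwards [isOpen_ne.mem_nhds hz0] with w hw
      simp [show w ≠ 0 from hw]
  · by_cases hz0 : z = 0
    · subst hz0
      rcases Nat.eq_zero_or_pos n with rfl | hpos
      · simp
      · have := hKg.self_of_nhds
        simpa [hpos.ne'] using this
    · simp [hz0, mul_div_cancel₀]

/-- Analytic functions on the unit disc vanishing to order greater than the degree of a polynomial
are orthogonal to that polynomial. -/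
theorem integral_mul_conj_polynomial_eq_zero {K : ℂ → ℂ}
    (hK : AnalyticOnNhd ℂ K (ball (0 : ℂ) 1)) (P : Polynomial ℂ)
    (hn : ((P.natDegree + 1 : ℕ) : ℕ∞) ≤ analyticOrderAt K 0) :
    ∫ z, K z * conj (P.eval z) ∂diskMeasure = 0 := by
  obtain ⟨g, hg, hKg⟩ := hK.exists_eq_pow_mul (mem_ball_self one_pos) hn
  rw [diskMeasure, integral_smul_measure,
    setIntegral_ball_eq_zero_of_circleAverage_eq_zero, smul_zero]
  intro ρ hρ hρ1
  set Q : ℂ → ℂ := fun z => (∑ k ∈ Finset.range (P.natDegree + 1),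
    conj (P.coeff k) * (ρ : ℂ) ^ (2 * k) * z ^ (P.natDegree + 1 - k)) * g z with hQ
  have hEq : Set.EqOn (fun z => K z * conj (P.eval z)) Q (sphere 0 |ρ|) := by
    intro z hz
    rw [abs_of_pos hρ, mem_sphere_zero_iff_norm] at hz
    have hzz : z * conj z = (ρ : ℂ) ^ 2 := by rw [Complex.mul_conj']; simp [hz]
    simp only [hQ, hKg z]
    rw [Polynomial.eval_eq_sum_range, map_sum, mul_right_comm, Finset.mul_sum]
    congr 1
    refine Finset.sum_congr rfl fun k hk => ?_
    have hk' : k ≤ P.natDegree + 1 := (Finset.mem_range.1 hk).le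
    rw [map_mul, map_pow, pow_mul, ← hzz, mul_pow]
    nth_rewrite 1 [← Nat.sub_add_cancel hk']
    rw [pow_add]
    ring
  rw [circleAverage_congr_sphere hEq, DiffContOnCl.circleAverage]
  · simp only [hQ]
    rw [Finset.sum_eq_zero, zero_mul]
    intro k hk
    rw [zero_pow (by have := Finset.mem_range.1 hk; omega), mul_zero]
  · rw [abs_of_pos hρ]
    have hQd : DifferentiableOn ℂ Q (ball 0 1) := by
      refine DifferentiableOn.mul ?_ hg.differentiableOn
      fun_prop
    refine (hQd.mono ?_).diffContOnCl
    exact (closure_ball_subset_closedBall).trans (closedBall_subset_ball hρ1)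

/-- Riemann's removable singularity theorem for a quotient of analytic functions: a bounded quotient
extends analytically. -/
theorem AnalyticOnNhd.exists_mul_eq_of_norm_le {U : Set ℂ} {F P : ℂ → ℂ}
    (hF : AnalyticOnNhd ℂ F U) (hP : AnalyticOnNhd ℂ P U)
    (hne : ∀ z ∈ U, ∀ᶠ w in 𝓝[≠] z, F w ≠ 0)
    (hle : ∀ z ∈ U, ∃ C : ℝ, ∀ᶠ w in 𝓝[≠] z, ‖P w‖ ≤ C * ‖F w‖) :
    ∃ H : ℂ → ℂ, AnalyticOnNhd ℂ H U ∧ ∀ z ∈ U, F z ≠ 0 → H z = P z / F z := by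
  have hm : MeromorphicOn (P / F) U := fun z hz =>
    (hP z hz).meromorphicAt.div (hF z hz).meromorphicAt
  refine ⟨toMeromorphicNFOn (P / F) U, fun z hz => ?_, fun z hz hFz => ?_⟩
  · rw [← (meromorphicNFOn_toMeromorphicNFOn (P / F) U hz).meromorphicOrderAt_nonneg_iff_analyticAt,
      meromorphicOrderAt_toMeromorphicNFOn hm hz]
    by_contra! hneg
    obtain ⟨C, hC⟩ := hle z hz
    have ht := tendsto_norm_cobounded_atTop.comp (tendsto_cobounded_of_meromorphicOrderAt_neg hneg)
    obtain ⟨w, h1, h2, h3⟩ := ((ht.eventually_gt_atTop C).and (hC.and (hne z hz))).exists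
    rw [Function.comp_apply, Pi.div_apply, norm_div, lt_div_iff₀ (norm_pos_iff.2 h3)] at h1
    exact absurd h2 h1.not_ge
  · rw [toMeromorphicNFOn_eq_toMeromorphicNFAt hm hz, toMeromorphicNFAt_eq_self.2]
    · rfl
    · exact ((hP z hz).div (hF z hz) hFz).meromorphicNFAt

/-- A branch `G` of `F ^ a` satisfies `‖G‖ = ‖F‖ ^ a`. -/
theorem IsPowerBranch.norm_eq {F G : ℂ → ℂ} {a : ℝ} (h : IsPowerBranch F a G) {z : ℂ}
    (hz : z ∈ ball (0 : ℂ) 1) : ‖G z‖ = ‖F z‖ ^ a := by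
  by_cases hF : F z = 0
  · rw [((h.2 z hz).2 hF).2, hF, norm_zero]
    by_cases ha : a = 0
    · simp [ha]
    · rw [Complex.zero_cpow (by exact_mod_cast ha), norm_zero, Real.zero_rpow ha]
  · obtain ⟨L, -, hL⟩ := (h.2 z hz).1 hF
    obtain ⟨h1, h2⟩ := hL.self_of_nhds
    rw [h2, ← h1, Complex.norm_exp, Complex.norm_exp, ← Real.exp_mul]
    simp [mul_comm]

/-- Norm comparison in `L^p` from a dual extremal kernel: if `ψ` satisfies `F ψ = ‖F‖ ^ p`,
`‖ψ‖ ≤ ‖F‖ ^ (p - 1)` and annihilates `f - F`, then `∫ ‖F‖ ^ p ≤ ∫ ‖f‖ ^ p`. -/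
theorem integral_rpow_le_of_integral_sub_mul_eq_zero {α : Type*} [MeasurableSpace α]
    {μ : Measure α} {p : ℝ} (hp : 1 < p) {f F ψ : α → ℂ}
    (hf : Integrable (fun z => ‖f z‖ ^ p) μ) (hF : Integrable (fun z => ‖F z‖ ^ p) μ)
    (hm : AEStronglyMeasurable (fun z => f z * ψ z) μ)
    (hFψ : ∀ᵐ z ∂μ, F z * ψ z = ((‖F z‖ ^ p : ℝ) : ℂ))
    (hψ : ∀ᵐ z ∂μ, ‖ψ z‖ ≤ ‖F z‖ ^ (p - 1))
    (h0 : ∫ z, (f z - F z) * ψ z ∂μ = 0) :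
    ∫ z, ‖F z‖ ^ p ∂μ ≤ ∫ z, ‖f z‖ ^ p ∂μ := by
  have hp0 : 0 < p := one_pos.trans hp
  have hpq := Real.HolderConjugate.conjExponent hp
  have hbound : ∀ᵐ z ∂μ, ‖f z * ψ z‖ ≤ ‖f z‖ ^ p / p + ‖F z‖ ^ p / p.conjExponent := by
    filter_upwards [hψ] with z hz
    have hy := Real.young_inequality_of_nonneg (norm_nonneg (f z))
      (Real.rpow_nonneg (norm_nonneg (F z)) (p - 1)) hpq
    rw [← Real.rpow_mul (norm_nonneg _), hpq.sub_one_mul_conj] at hy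
    rw [norm_mul]
    exact (mul_le_mul_of_nonneg_left hz (norm_nonneg _)).trans hy
  have hB : Integrable (fun z => ‖f z‖ ^ p / p + ‖F z‖ ^ p / p.conjExponent) μ :=
    (hf.div_const _).add (hF.div_const _)
  have hfi : Integrable (fun z => f z * ψ z) μ := hB.mono' hm hbound
  have hFi : Integrable (fun z => F z * ψ z) μ :=
    hF.ofReal.congr (hFψ.mono fun z hz => hz.symm)
  simp only [sub_mul] at h0
  rw [integral_sub hfi hFi, sub_eq_zero, integral_congr_ae hFψ, integral_complex_ofReal] at h0
  have hle : ∫ z, ‖F z‖ ^ p ∂μ ≤ ∫ z, (‖f z‖ ^ p / p + ‖F z‖ ^ p / p.conjExponent) ∂μ := by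
    refine le_trans ?_ (integral_mono_ae hfi.norm hB hbound)
    refine le_trans ?_ (norm_integral_le_integral_norm _)
    rw [h0, Complex.norm_real]
    exact le_abs_self _
  rw [integral_add (hf.div_const _) (hF.div_const _), integral_div, integral_div,
    div_eq_mul_inv _ p.conjExponent, ← hpq.one_sub_inv] at hle
  have h2 : (∫ z, ‖F z‖ ^ p ∂μ) / p ≤ (∫ z, ‖f z‖ ^ p ∂μ) / p := by
    rw [div_eq_mul_inv (∫ z, ‖F z‖ ^ p ∂μ)]; linarith
  exact (div_le_div_iff_of_pos_right hp0).1 h2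

/-- The analytic quotient `P / F = F ^ (p / 2 - 1)`. -/
theorem exists_analytic_quotient {p : ℝ} {F P : ℂ → ℂ}
    (hF : AnalyticOnNhd ℂ F (ball (0 : ℂ) 1)) (hP : AnalyticOnNhd ℂ P (ball (0 : ℂ) 1))
    (hFP : ∀ z ∈ ball (0 : ℂ) 1, ‖P z‖ = ‖F z‖ ^ (p / 2))
    (hp : p < 2 → ∀ z ∈ ball (0 : ℂ) 1, F z ≠ 0) (hF0 : ∃ z ∈ ball (0 : ℂ) 1, F z ≠ 0) :
    ∃ H : ℂ → ℂ, AnalyticOnNhd ℂ H (ball (0 : ℂ) 1) ∧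
      ∀ z ∈ ball (0 : ℂ) 1, F z ≠ 0 → H z = P z / F z := by
  by_cases hp2 : p < 2
  · exact ⟨fun z => P z / F z, fun z hz => (hP z hz).div (hF z hz) (hp hp2 z hz), fun _ _ _ => rfl⟩
  have hne : ∀ z ∈ ball (0 : ℂ) 1, ∀ᶠ w in 𝓝[≠] z, F w ≠ 0 := fun z hz => by
    refine ((hF z hz).eventually_eq_zero_or_eventually_ne_zero).resolve_left fun h => ?_
    obtain ⟨w, hw, hFw⟩ := hF0
    exact hFw (hF.eqOn_zero_of_preconnected_of_eventuallyEq_zero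
      (convex_ball (0 : ℂ) 1).isPreconnected hz h hw)
  refine hF.exists_mul_eq_of_norm_le hP hne fun z hz => ⟨(‖F z‖ + 1) ^ (p / 2 - 1), ?_⟩
  have hlt : ∀ᶠ w in 𝓝 z, ‖F w‖ < ‖F z‖ + 1 :=
    (hF z hz).continuousAt.norm.eventually_lt_const (by linarith)
  filter_upwards [nhdsWithin_le_nhds hlt, nhdsWithin_le_nhds (isOpen_ball.mem_nhds hz), hne z hz]
    with w h1 h2 h3
  have hpos : 0 < ‖F w‖ := norm_pos_iff.2 h3
  rw [hFP w h2, show p / 2 = (p / 2 - 1) + 1 by ring, Real.rpow_add hpos, Real.rpow_one,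
    add_sub_cancel_right]
  exact mul_le_mul_of_nonneg_right
    (Real.rpow_le_rpow hpos.le h1.le (by linarith)) hpos.le

theorem ae_diskMeasure_of_forall_mem_ball {q : ℂ → Prop} (h : ∀ z ∈ ball (0 : ℂ) 1, q z) :
    ∀ᵐ z ∂diskMeasure, q z :=
  Measure.ae_smul_measure (ae_restrict_of_forall_mem measurableSet_ball h) _

theorem mainTheorem7 (p : ℝ) (hp : 1 < p) (F : ℂ → ℂ) (hF : MemBergman p F)
    (P : Polynomial ℂ) (N : ℕ) (hN : P.natDegree = N)
    (hP : IsPowerBranch F (p / 2) (fun z => P.eval z))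
    (hG : p < 2 → ∃ p₁ : ℝ, 1 < p₁ ∧
      ∃ G : ℂ → ℂ, IsPowerBranch F (p / 2 - 1) G ∧ MemBergman p₁ G) :
    IsLeast
      {r : ℝ | ∃ f : ℂ → ℂ, MemBergman p f ∧
        (∀ j : ℕ, j ≤ N → iteratedDeriv j f 0 = iteratedDeriv j F 0) ∧ r = bergmanNorm p f}
      (bergmanNorm p F) := by
  subst hN
  refine ⟨⟨F, hF, fun _ _ => rfl, rfl⟩, ?_⟩
  rintro _ ⟨f, hf, hder, rfl⟩
  have hp0 : 0 < p := one_pos.trans hp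
  have h00 : (0 : ℂ) ∈ ball (0 : ℂ) 1 := mem_ball_self one_pos
  have hFn : ∀ z, 0 ≤ ‖F z‖ ^ p := fun z => Real.rpow_nonneg (norm_nonneg _) p
  have hfn : ∀ z, 0 ≤ ‖f z‖ ^ p := fun z => Real.rpow_nonneg (norm_nonneg _) p
  refine Real.rpow_le_rpow (integral_nonneg hFn) ?_ (by positivity)
  by_cases hF0 : ∃ z ∈ ball (0 : ℂ) 1, F z ≠ 0
  swap
  · push Not at hF0
    rw [integral_eq_zero_of_ae (ae_diskMeasure_of_forall_mem_ball fun z hz => by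
      simp [hF0 z hz, hp0.ne'])]
    exact integral_nonneg hfn
  have hFP : ∀ z ∈ ball (0 : ℂ) 1, ‖P.eval z‖ = ‖F z‖ ^ (p / 2) := fun z hz => hP.norm_eq hz
  have hzf : p < 2 → ∀ z ∈ ball (0 : ℂ) 1, F z ≠ 0 := fun hp2 z hz hz0 => by
    obtain ⟨p₁, -, G, hGb, -⟩ := hG hp2
    linarith [((hGb.2 z hz).2 hz0).1]
  obtain ⟨H, hH, hHq⟩ := exists_analytic_quotient hF.1 hP.1 hFP hzf hF0
  have hP0 : ∀ z ∈ ball (0 : ℂ) 1, F z = 0 → P.eval z = 0 := fun z hz h => by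
    rw [← norm_eq_zero, hFP z hz, h, norm_zero, Real.zero_rpow (by positivity)]
  have hsq : ∀ z ∈ ball (0 : ℂ) 1, ‖P.eval z‖ ^ 2 = ‖F z‖ ^ p := fun z hz => by
    rw [hFP z hz, ← Real.rpow_natCast, ← Real.rpow_mul (norm_nonneg _)]
    norm_num
  refine integral_rpow_le_of_integral_sub_mul_eq_zero (ψ := fun z => H z * conj (P.eval z)) hp
    hf.2 hF.2 ?_ (ae_diskMeasure_of_forall_mem_ball fun z hz => ?_)
    (ae_diskMeasure_of_forall_mem_ball fun z hz => ?_) ?_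
  · refine AEStronglyMeasurable.smul_measure ?_ _
    refine ContinuousOn.aestronglyMeasurable ?_ measurableSet_ball
    exact hf.1.continuousOn.mul (hH.continuousOn.mul
      (Complex.continuous_conj.comp P.continuous).continuousOn)
  · by_cases h : F z = 0
    · simp [h, hp0.ne']
    · rw [hHq z hz h, ← mul_assoc, mul_div_cancel₀ _ h, Complex.mul_conj', ← hsq z hz]
      push_cast
      rfl
  · by_cases h : F z = 0
    · rw [hP0 z hz h, map_zero, mul_zero, norm_zero]
      positivity
    · have hpos := norm_pos_iff.2 h
      rw [hHq z hz h, norm_mul, norm_div, RCLike.norm_conj, Real.rpow_sub_one hpos.ne', ← hsq z hz]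
      exact le_of_eq (by ring)
  · have hK := integral_mul_conj_polynomial_eq_zero (K := (f - F) * H)
      ((hf.1.sub hF.1).mul hH) P ?_
    · simpa [mul_assoc] using hK
    · rw [analyticOrderAt_mul ((hf.1 0 h00).sub (hF.1 0 h00)) (hH 0 h00)]
      refine le_add_right ?_
      rw [natCast_le_analyticOrderAt_iff_iteratedDeriv_eq_zero ((hf.1 0 h00).sub (hF.1 0 h00))]
      intro j hj
      rw [iteratedDeriv_sub (hf.1 0 h00).contDiffAt (hF.1 0 h00).contDiffAt,
        hder j (Nat.lt_succ_iff.1 hj), sub_self]
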